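/- Let $n\ge 2$ be a perfect square and $1\le m\le n$. Consider gossip among $n+m$ agents on the $\sqrt n\times\sqrt n$ discrete torus $\mathcal G$ (the Cartesian product of two cycles of length $\sqrt n$): $n$ static agents, one at each vertex, and $m$ mobile agents. At each time $t=1,2,\dots$, independently of the past, each mobile agent moves to an independent uniformly random vertex of $\mathcal G$; then an agent $i$ is selected uniformly among all $n+m$ agents and it selects an agent $j$ uniformly among the other agents located at the same vertex as $i$ or at an adjacent vertex; then $i$ and $j$ both replace their real values $x_i(t-1),x_j(t-1)$ by $\tfrac12\bigl(x_i(t-1)+x_j(t-1)\bigr)$, and all other agents keep their values. Let $\bar x$ be the average of the $n+m$ initial values, $\|\cdot\|$ the $\ell_2$ norm, $\vec 1$ the all-ones vector, and $$T_{\mathrm{ave}}(n,m,\epsilon)=\sup_{x(0)\neq 0}\ \inf\Bigl\{t\in\{0,1,2,\dots\}:\ \mathbb P\Bigl(\frac{\|x(t)-\bar x\vec 1\|}{\|x(0)\|}\ge\epsilon\Bigr)\le\epsilon\Bigr\}.$$ Then $T_{\mathrm{ave}}(n,m,\epsilon)=\Theta\bigl(\frac{n^2}{m}\log\epsilon^{-1}\bigr)$.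 That is, for every $\epsilon_0\in(0,1)$ there are constants $c,C>0$, depending only on $\epsilon_0$, such that for all perfect squares $n\ge 2$, all integers $1\le m\le n$ and all $0<\epsilon\le\epsilon_0$, $$c\,\frac{n^2}{m}\log\epsilon^{-1}\ \le\ T_{\mathrm{ave}}(n,m,\epsilon)\ \le\ C\,\frac{n^2}{m}\log\epsilon^{-1}.$$ -/

import Mathlib

open scoped ENNReal

noncomputable section

/-- The joint law of independent agent locations, agent `i` being distributed according to `μ i`. -/
def locationLaw {A V : Type*} [Fintype A] [Fintype V] (μ : A → PMF V) : PMF (A → V) := by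
  classical
  exact PMF.ofFintype (fun l => ∏ i, μ i (l i)) (by
    have h := Finset.prod_univ_sum (fun _ : A => (Finset.univ : Finset V)) (fun i v => μ i v)
    rw [Fintype.piFinset_univ] at h
    rw [← h]
    refine Finset.prod_eq_one fun i _ => ?_
    rw [← tsum_fintype (L := .unconditional _)]
    exact (μ i).tsum_coe)

open Classical in
/-- The agents other than `i` with which agent `i` can communicate when the agents are at the
locations `l`: those at the same vertex as `i` or at an adjacent vertex. -/
def gossipNeighbors {A V : Type*} [Fintype A] (G : SimpleGraph V) (l : A → V) (i : A) :
    Finset A :=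
  Finset.univ.filter fun k => k ≠ i ∧ (l i = l k ∨ G.Adj (l i) (l k))

open Classical in
/-- Agent `i` chooses one of its neighbors uniformly at random. An agent without a neighbor
chooses itself, which leaves all values unchanged. -/
def chooseNeighbor {A V : Type*} [Fintype A] (G : SimpleGraph V) (l : A → V) (i : A) : PMF A :=
  if h : (gossipNeighbors G l i).Nonempty then PMF.uniformOfFinset (gossipNeighbors G l i) h
  else PMF.pure i

open Classical in
/-- Agents `i` and `j` replace their values by the mean of the two values. -/
def pairAverage {A : Type*} (i j : A) (x : A → ℝ) : A → ℝ :=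
  fun k => if k = i ∨ k = j then (x i + x j) / 2 else x k

/-- One time step of gossip from the vector of values `x`: all agents move independently according
to `μ`, a uniformly random agent wakes up, chooses a uniformly random neighbor, and the two
average their values. -/
def gossipStep {A V : Type*} [Fintype A] [Nonempty A] [Fintype V] (G : SimpleGraph V)
    (μ : A → PMF V) (x : A → ℝ) : PMF (A → ℝ) :=
  (locationLaw μ).bind fun l =>
    (PMF.uniformOfFintype A).bind fun i =>
      (chooseNeighbor G l i).map fun j => pairAverage i j x

/-- The law of the vector of values at time `t` when the initial vector is `x₀`. The moves and
choices at different times are independent. -/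
def gossipLaw {A V : Type*} [Fintype A] [Nonempty A] [Fintype V] (G : SimpleGraph V)
    (μ : A → PMF V) (x₀ : A → ℝ) : ℕ → PMF (A → ℝ)
  | 0 => PMF.pure x₀
  | t + 1 => (gossipLaw G μ x₀ t).bind (gossipStep G μ)

/-- The average of the entries of a vector. -/
def vecMean {A : Type*} [Fintype A] (x : A → ℝ) : ℝ := (∑ i, x i) / (Fintype.card A : ℝ)

/-- The `ℓ²` distance of the current values `x` to the average of the initial values `x₀`, relative
to the `ℓ²` norm of `x₀`. -/
def relError {A : Type*} [Fintype A] (x₀ x : A → ℝ) : ℝ :=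
  ‖WithLp.toLp 2 (fun i => x i - vecMean x₀)‖ / ‖WithLp.toLp 2 x₀‖

/-- The `ε`-averaging time: the supremum over nonzero initial vectors of the first time at which
the relative error is at least `ε` with probability at most `ε` (it is `⊤` if there is no bound). -/
def averagingTime {A V : Type*} [Fintype A] [Nonempty A] [Fintype V] (G : SimpleGraph V)
    (μ : A → PMF V) (ε : ℝ) : ℕ∞ :=
  ⨆ (x₀ : A → ℝ) (_ : x₀ ≠ 0),
    ⨅ (t : ℕ) (_ : (gossipLaw G μ x₀ t).toOuterMeasure {x | ε ≤ relError x₀ x}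
      ≤ ENNReal.ofReal ε), (t : ℕ∞)

/-- The `L × L` discrete torus. -/
def torusGraph (L : ℕ) : SimpleGraph (Fin L × Fin L) :=
  (SimpleGraph.cycleGraph L).boxProd (SimpleGraph.cycleGraph L)

/-- One static agent `Sum.inl v` at each vertex `v` of the torus, and `m` mobile agents, whose
location is uniform on the torus. -/
def staticPlusMobile (L m : ℕ) [NeZero L] :
    (Fin L × Fin L) ⊕ Fin m → PMF (Fin L × Fin L)
  | Sum.inl v => PMF.pure v
  | Sum.inr _ => PMF.uniformOfFintype (Fin L × Fin L)

end

/-!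
The pair of agents that average at one time step is independent of the values, so with
`q = pairLaw G μ` the process applies independent random projections `z ↦ pairAverage i j z`, with
`(i, j)` of law `q`. The elementary identity
`⟪y, pairAverage i j z⟫ = ⟪y, z⟫ - (yᵢ - yⱼ) (zᵢ - zⱼ) / 2` (`dotProduct_pairAverage`) relates both
the squared deviation from the mean (`spread`) and the expected step (`meanStep`) to the Dirichlet
form `pairEnergy q`. Expectations at time `t` are powers of the Markov operator `pairOp q`
(`tsum_gossipLaw_mul`). Let `n = L ^ 2`.

Upper bound. If `2 γ spread ≤ pairEnergy q`, the expected spread decays like `(1 - γ) ^ t`, and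
Markov's inequality gives the averaging time `3 log (1 / ε) / γ` (`averagingTime_le`). One may take
`γ` of order `m / n ^ 2`, using only the exchanges between static and mobile agents: each static
agent chooses each mobile agent with probability at least of order `1 / n ^ 2`
(`le_pairLaw_inl_inr`), and the complete bipartite graph with sides `m ≤ n` has spectral gap `m`
(`card_mul_spread_le`).

Lower bound. A vector `x` of mean zero with Rayleigh quotient `pairEnergy q x / (2 ‖x‖ ^ 2) ≤ δ`
has expectation of norm at least `(1 - δ) ^ t ‖x‖` at time `t`, since `meanStep q` is symmetric and
the norms of its iterates are log-convex (`pow_mul_norm_le_norm_meanStep_iterate`). As the relative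
error is at most `1`, it follows that `(1 - δ) ^ t ≤ ε (2 - ε)` at the averaging time
(`pow_le_of_toOuterMeasure_relError_le`). The first trigonometric mode of the torus at the static
agents, extended by `0` to the mobile agents, has `δ` of order `m / n ^ 2`: exchanges between
neighboring static agents cost `O(1 / n)` each, and static-mobile exchanges happen with
probability `O(m / n)` (`exists_slow_vector`).
-/

/-! ### Averaging along one random pair -/

section PairAverage

variable {A : Type*} [Fintype A]

theorem norm_toLp_sq (x : A → ℝ) : ‖WithLp.toLp 2 x‖ ^ 2 = x ⬝ᵥ x := by
  rw [EuclideanSpace.real_norm_sq_eq]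
  simp [dotProduct, sq]

theorem dotProduct_le_norm_mul_norm (x y : A → ℝ) :
    x ⬝ᵥ y ≤ ‖WithLp.toLp 2 x‖ * ‖WithLp.toLp 2 y‖ := by
  refine le_of_eq_of_le ?_ (real_inner_le_norm (WithLp.toLp 2 x) (WithLp.toLp 2 y))
  simp [PiLp.inner_apply, dotProduct, mul_comm]

omit [Fintype A] in
open Classical in
/-- Averaging the entries `i` and `j` is the orthogonal projection along `eᵢ - eⱼ`. -/
theorem pairAverage_eq_sub (i j : A) (z : A → ℝ) :
    pairAverage i j z = z - ((z i - z j) / 2) • (Pi.single i 1 - Pi.single j 1) := by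
  funext k
  by_cases hi : k = i <;> by_cases hj : k = j
  · subst hi; subst hj; simp [pairAverage]
  · subst hi; simp [pairAverage, hj]; ring
  · subst hj; simp [pairAverage, hi]; ring
  · simp [pairAverage, hi, hj]

theorem dotProduct_pairAverage (i j : A) (y z : A → ℝ) :
    y ⬝ᵥ pairAverage i j z = y ⬝ᵥ z - (y i - y j) * (z i - z j) / 2 := by
  classical
  rw [pairAverage_eq_sub, dotProduct_sub, dotProduct_smul, dotProduct_sub,
    dotProduct_single_one, dotProduct_single_one, smul_eq_mul]
  ring

theorem pairAverage_dotProduct_self (i j : A) (z : A → ℝ) :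
    pairAverage i j z ⬝ᵥ pairAverage i j z = z ⬝ᵥ z - (z i - z j) ^ 2 / 2 := by
  have h : pairAverage i j z i = pairAverage i j z j := by simp [pairAverage]
  rw [dotProduct_pairAverage, h, sub_self, dotProduct_comm, dotProduct_pairAverage]
  ring

theorem norm_pairAverage_le (i j : A) (z : A → ℝ) :
    ‖WithLp.toLp 2 (pairAverage i j z)‖ ≤ ‖WithLp.toLp 2 z‖ := by
  refine (sq_le_sq₀ (norm_nonneg _) (norm_nonneg _)).1 ?_
  rw [norm_toLp_sq, norm_toLp_sq, pairAverage_dotProduct_self]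
  linarith [sq_nonneg (z i - z j)]

theorem vecMean_pairAverage (i j : A) (z : A → ℝ) :
    vecMean (pairAverage i j z) = vecMean z := by
  have h := dotProduct_pairAverage i j 1 z
  simp only [one_dotProduct, Pi.one_apply, sub_self, zero_mul, zero_div, sub_zero] at h
  rw [vecMean, vecMean, h]

/-- The sum of the squared deviations from the mean. -/
noncomputable def spread (x : A → ℝ) : ℝ := ∑ i, (x i - vecMean x) ^ 2

theorem spread_eq [Nonempty A] (x : A → ℝ) :
    spread x = x ⬝ᵥ x - (Fintype.card A : ℝ) * vecMean x ^ 2 := by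
  have hN : (Fintype.card A : ℝ) ≠ 0 := by exact_mod_cast Fintype.card_ne_zero
  have hs : ∑ i, x i = (Fintype.card A : ℝ) * vecMean x := by
    rw [vecMean]; field_simp
  simp only [spread, sub_sq, Finset.sum_add_distrib, Finset.sum_sub_distrib, Finset.sum_const,
    Finset.card_univ, nsmul_eq_mul, dotProduct, ← sq]
  rw [← Finset.sum_mul, ← Finset.mul_sum, hs]
  ring

theorem spread_nonneg (x : A → ℝ) : 0 ≤ spread x := Finset.sum_nonneg fun _ _ => sq_nonneg _

theorem spread_le [Nonempty A] (x : A → ℝ) : spread x ≤ ‖WithLp.toLp 2 x‖ ^ 2 := by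
  rw [spread_eq, norm_toLp_sq]
  have : 0 ≤ (Fintype.card A : ℝ) * vecMean x ^ 2 := by positivity
  linarith

theorem spread_pairAverage [Nonempty A] (i j : A) (z : A → ℝ) :
    spread (pairAverage i j z) = spread z - (z i - z j) ^ 2 / 2 := by
  rw [spread_eq, spread_eq, pairAverage_dotProduct_self, vecMean_pairAverage]
  ring

end PairAverage

/-! ### The Markov operator of pairwise averaging -/

section Operator

variable {A : Type*} [Fintype A]

theorem sum_toReal_eq_one {B : Type*} [Fintype B] (q : PMF B) : ∑ b, (q b).toReal = 1 := by
  rw [← ENNReal.toReal_sum fun b _ => q.apply_ne_top b, ← tsum_fintype (L := .unconditional _),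
    q.tsum_coe, ENNReal.toReal_one]

/-- The Markov operator on observables: `pairOp q F x` is the expectation of `F` after the random
pair with law `q` has averaged its values, starting from `x`. -/
noncomputable def pairOp (q : PMF (A × A)) (F : (A → ℝ) → ℝ) (x : A → ℝ) : ℝ :=
  ∑ p, (q p).toReal * F (pairAverage p.1 p.2 x)

/-- The expectation of the vector of values after one averaging step. -/
noncomputable def meanStep (q : PMF (A × A)) (x : A → ℝ) : A → ℝ :=
  ∑ p, (q p).toReal • pairAverage p.1 p.2 x

/-- The Dirichlet form of the random pair with law `q`. -/
noncomputable def pairEnergy (q : PMF (A × A)) (x : A → ℝ) : ℝ :=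
  ∑ p, (q p).toReal * (x p.1 - x p.2) ^ 2

variable (q : PMF (A × A))

theorem pairOp_mono_on {S : Set (A → ℝ)} (hS : ∀ i j, ∀ x ∈ S, pairAverage i j x ∈ S)
    {F H : (A → ℝ) → ℝ} (h : ∀ x ∈ S, F x ≤ H x) : ∀ x ∈ S, pairOp q F x ≤ pairOp q H x :=
  fun x hx => Finset.sum_le_sum fun p _ =>
    mul_le_mul_of_nonneg_left (h _ (hS p.1 p.2 x hx)) ENNReal.toReal_nonneg

theorem pairOp_iterate_mono_on {S : Set (A → ℝ)}
    (hS : ∀ i j, ∀ x ∈ S, pairAverage i j x ∈ S) (t : ℕ) {F H : (A → ℝ) → ℝ}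
    (h : ∀ x ∈ S, F x ≤ H x) : ∀ x ∈ S, (pairOp q)^[t] F x ≤ (pairOp q)^[t] H x := by
  induction t generalizing F H with
  | zero => exact h
  | succ t ih => exact ih (pairOp_mono_on q hS h)

theorem pairOp_affine (a b : ℝ) (F : (A → ℝ) → ℝ) :
    pairOp q (fun x => a + b * F x) = fun x => a + b * pairOp q F x := by
  funext x
  have h : ∀ p : A × A, (q p).toReal * (a + b * F (pairAverage p.1 p.2 x)) =
      (q p).toReal * a + b * ((q p).toReal * F (pairAverage p.1 p.2 x)) := fun p => by ring
  simp only [pairOp, h, Finset.sum_add_distrib, ← Finset.sum_mul, ← Finset.mul_sum,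
    sum_toReal_eq_one q, one_mul]

theorem pairOp_iterate_affine (a b : ℝ) (t : ℕ) (F : (A → ℝ) → ℝ) (x : A → ℝ) :
    (pairOp q)^[t] (fun x => a + b * F x) x = a + b * (pairOp q)^[t] F x := by
  induction t generalizing F with
  | zero => rfl
  | succ t ih => rw [Function.iterate_succ_apply, pairOp_affine, ih, Function.iterate_succ_apply]

theorem pairOp_nonneg {F : (A → ℝ) → ℝ} (hF : ∀ x, 0 ≤ F x) (x : A → ℝ) : 0 ≤ pairOp q F x :=
  Finset.sum_nonneg fun _ _ => mul_nonneg ENNReal.toReal_nonneg (hF _)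

theorem dotProduct_meanStep (y z : A → ℝ) :
    y ⬝ᵥ meanStep q z =
      y ⬝ᵥ z - (∑ p, (q p).toReal * ((y p.1 - y p.2) * (z p.1 - z p.2))) / 2 := by
  have h : ∀ p : A × A, (q p).toReal * (y ⬝ᵥ z - (y p.1 - y p.2) * (z p.1 - z p.2) / 2) =
      (q p).toReal * (y ⬝ᵥ z) - (q p).toReal * ((y p.1 - y p.2) * (z p.1 - z p.2)) / 2 :=
    fun p => by ring
  simp only [meanStep, dotProduct_sum, dotProduct_smul, dotProduct_pairAverage, smul_eq_mul, h,
    Finset.sum_sub_distrib, ← Finset.sum_mul, sum_toReal_eq_one q, one_mul, ← Finset.sum_div]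

theorem dotProduct_meanStep_self (z : A → ℝ) :
    z ⬝ᵥ meanStep q z = z ⬝ᵥ z - pairEnergy q z / 2 := by
  rw [dotProduct_meanStep, pairEnergy]
  simp only [sq]

theorem dotProduct_meanStep_comm (y z : A → ℝ) :
    y ⬝ᵥ meanStep q z = meanStep q y ⬝ᵥ z := by
  rw [dotProduct_comm (meanStep q y), dotProduct_meanStep, dotProduct_meanStep,
    dotProduct_comm y z]
  simp only [mul_comm]

theorem dotProduct_meanStep_iterate_comm (t : ℕ) (y z : A → ℝ) :
    y ⬝ᵥ (meanStep q)^[t] z = (meanStep q)^[t] y ⬝ᵥ z := by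
  induction t generalizing y z with
  | zero => rfl
  | succ t ih =>
    rw [Function.iterate_succ_apply, ih, dotProduct_meanStep_comm, Function.iterate_succ_apply']

theorem pairOp_iterate_dotProduct (t : ℕ) (y : A → ℝ) :
    (pairOp q)^[t] (fun x => y ⬝ᵥ x) = fun x => (meanStep q)^[t] y ⬝ᵥ x := by
  induction t generalizing y with
  | zero => rfl
  | succ t ih =>
    have h : pairOp q (fun x => y ⬝ᵥ x) = fun x => meanStep q y ⬝ᵥ x := by
      funext x
      rw [← dotProduct_meanStep_comm]
      simp only [pairOp, meanStep, dotProduct_sum, dotProduct_smul, smul_eq_mul]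
    rw [Function.iterate_succ_apply, h, ih, Function.iterate_succ_apply]

theorem pairOp_spread [Nonempty A] (x : A → ℝ) :
    pairOp q spread x = spread x - pairEnergy q x / 2 := by
  simp only [pairOp, spread_pairAverage, mul_sub, Finset.sum_sub_distrib, ← Finset.sum_mul,
    sum_toReal_eq_one q, one_mul, pairEnergy, Finset.sum_div, mul_div_assoc]

theorem pairOp_iterate_spread_le [Nonempty A] {γ : ℝ} (hγ : γ ≤ 1)
    (h : ∀ x, 2 * γ * spread x ≤ pairEnergy q x) (t : ℕ) (x : A → ℝ) :
    (pairOp q)^[t] spread x ≤ (1 - γ) ^ t * spread x := by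
  induction t with
  | zero => simp
  | succ t ih =>
    have h1 : ∀ z ∈ (Set.univ : Set (A → ℝ)), pairOp q spread z ≤ 0 + (1 - γ) * spread z := by
      intro z _
      rw [pairOp_spread]
      linarith [h z]
    have h2 := pairOp_iterate_mono_on q (S := Set.univ) (fun _ _ _ _ => trivial) t h1 x trivial
    rw [pairOp_iterate_affine, zero_add] at h2
    rw [Function.iterate_succ_apply, pow_succ', mul_assoc]
    exact h2.trans (mul_le_mul_of_nonneg_left ih (by linarith))

/-- A small Rayleigh quotient controls the decay of all powers: since `meanStep q` is symmetric,
Cauchy-Schwarz makes the norms of its iterates log-convex, so that the ratios of consecutive norms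
are at least the first one. -/
theorem pow_mul_norm_le_norm_meanStep_iterate {δ : ℝ} (hδ : δ < 1) {x : A → ℝ} (hx : x ≠ 0)
    (h : pairEnergy q x ≤ 2 * δ * (x ⬝ᵥ x)) (t : ℕ) :
    (1 - δ) ^ t * ‖WithLp.toLp 2 x‖ ≤ ‖WithLp.toLp 2 ((meanStep q)^[t] x)‖ := by
  set b : ℕ → ℝ := fun t => ‖WithLp.toLp 2 ((meanStep q)^[t] x)‖ with hb
  have hx0 : 0 < b 0 := by simpa [hb] using hx
  have hconv : ∀ t, b (t + 1) ^ 2 ≤ b t * b (t + 2) := by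
    intro t
    simp only [hb]
    rw [norm_toLp_sq]
    refine le_of_eq_of_le ?_ (dotProduct_le_norm_mul_norm _ _)
    rw [Function.iterate_succ_apply' _ (t + 1), dotProduct_meanStep_comm,
      ← Function.iterate_succ_apply' (meanStep q) t]
  have key : ∀ t, 0 < b t ∧ (1 - δ) * b t ≤ b (t + 1) := by
    intro t
    induction t with
    | zero =>
      refine ⟨hx0, ?_⟩
      have h1 := dotProduct_le_norm_mul_norm x (meanStep q x)
      rw [dotProduct_meanStep_self] at h1
      have h2 : (1 - δ) * b 0 * b 0 ≤ b 1 * b 0 := by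
        have h3 : b 0 ^ 2 = x ⬝ᵥ x := norm_toLp_sq x
        have h4 : b 0 * b 1 = ‖WithLp.toLp 2 x‖ * ‖WithLp.toLp 2 (meanStep q x)‖ := rfl
        nlinarith
      exact le_of_mul_le_mul_right h2 hx0
    | succ t ih =>
      have h1 : 0 < b (t + 1) := lt_of_lt_of_le (mul_pos (by linarith) ih.1) ih.2
      refine ⟨h1, ?_⟩
      have h2 : b t * ((1 - δ) * b (t + 1)) ≤ b t * b (t + 2) := by
        nlinarith [hconv t, mul_le_mul_of_nonneg_right ih.2 h1.le]
      exact le_of_mul_le_mul_left h2 ih.1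
  change (1 - δ) ^ t * b 0 ≤ b t
  induction t with
  | zero => simp
  | succ t ih =>
    rw [pow_succ', mul_assoc]
    exact (mul_le_mul_of_nonneg_left ih (by linarith)).trans (key t).2

end Operator

/-! ### The gossip process as an averaging of random pairs -/

section Gossip

variable {A V : Type*} [Fintype A] [Nonempty A] [Fintype V] (G : SimpleGraph V) (μ : A → PMF V)

/-- The law of the pair formed by the agent that wakes up and the agent that it chooses. It does
not depend on the values of the agents. -/
noncomputable def pairLaw : PMF (A × A) :=
  (locationLaw μ).bind fun l =>
    (PMF.uniformOfFintype A).bind fun i => (chooseNeighbor G l i).map fun j => (i, j)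

theorem gossipStep_eq_map (x : A → ℝ) :
    gossipStep G μ x = (pairLaw G μ).map fun p => pairAverage p.1 p.2 x := by
  simp only [gossipStep, pairLaw, PMF.map_bind, PMF.map_comp]
  rfl

theorem tsum_map_mul {B C : Type*} [Fintype B] (p : PMF B) (f : B → C) (F : C → ℝ≥0∞) :
    ∑' c, p.map f c * F c = ∑ b, p b * F (f b) := by
  classical
  simp only [PMF.map_apply, tsum_fintype, ite_mul, zero_mul, Finset.sum_mul]
  rw [Summable.tsum_finsetSum fun _ _ => ENNReal.summable]
  refine Finset.sum_congr rfl fun b _ => ?_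
  rw [tsum_eq_single (f b) (fun c hc => by simp [hc])]
  simp

theorem tsum_gossipStep_mul {F : (A → ℝ) → ℝ} (hF : ∀ x, 0 ≤ F x) (x : A → ℝ) :
    ∑' z, gossipStep G μ x z * ENNReal.ofReal (F z) =
      ENNReal.ofReal (pairOp (pairLaw G μ) F x) := by
  rw [gossipStep_eq_map, tsum_map_mul, pairOp,
    ENNReal.ofReal_sum_of_nonneg fun p _ => mul_nonneg ENNReal.toReal_nonneg (hF _)]
  refine Finset.sum_congr rfl fun p _ => ?_
  rw [ENNReal.ofReal_mul ENNReal.toReal_nonneg, ENNReal.ofReal_toReal (PMF.apply_ne_top _ _)]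

theorem tsum_gossipLaw_mul (x₀ : A → ℝ) (t : ℕ) {F : (A → ℝ) → ℝ} (hF : ∀ x, 0 ≤ F x) :
    ∑' z, gossipLaw G μ x₀ t z * ENNReal.ofReal (F z) =
      ENNReal.ofReal ((pairOp (pairLaw G μ))^[t] F x₀) := by
  induction t generalizing F with
  | zero =>
    classical
    simp only [gossipLaw, Function.iterate_zero, id_eq]
    rw [tsum_eq_single x₀ (fun z hz => by simp [PMF.pure_apply, hz])]
    simp
  | succ t ih =>
    rw [Function.iterate_succ_apply, ← ih (pairOp_nonneg _ hF)]
    simp only [gossipLaw, PMF.bind_apply, ← ENNReal.tsum_mul_right]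
    rw [ENNReal.tsum_comm]
    refine tsum_congr fun z => ?_
    rw [← tsum_gossipStep_mul G μ hF, ← ENNReal.tsum_mul_left]
    simp only [mul_assoc]

theorem toOuterMeasure_gossipLaw (x₀ : A → ℝ) (t : ℕ) (s : Set (A → ℝ)) :
    (gossipLaw G μ x₀ t).toOuterMeasure s =
      ENNReal.ofReal ((pairOp (pairLaw G μ))^[t] (s.indicator 1) x₀) := by
  classical
  rw [← tsum_gossipLaw_mul G μ x₀ t (fun x => Set.indicator_nonneg (by simp) x),
    PMF.toOuterMeasure_apply]
  refine tsum_congr fun z => ?_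
  by_cases hz : z ∈ s <;> simp [hz]

/-- Markov's inequality for the squared relative error. -/
theorem toOuterMeasure_relError_le {γ : ℝ} (hγ : γ ≤ 1)
    (h : ∀ x, 2 * γ * spread x ≤ pairEnergy (pairLaw G μ) x) {ε : ℝ} (hε : 0 < ε)
    {x₀ : A → ℝ} (hx₀ : x₀ ≠ 0) {t : ℕ} (ht : (1 - γ) ^ t ≤ ε ^ 3) :
    (gossipLaw G μ x₀ t).toOuterMeasure {x | ε ≤ relError x₀ x} ≤ ENNReal.ofReal ε := by
  rw [toOuterMeasure_gossipLaw]
  apply ENNReal.ofReal_le_ofReal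
  have hR : 0 < ‖WithLp.toLp 2 x₀‖ := by simpa using hx₀
  set R := ‖WithLp.toLp 2 x₀‖ with hRdef
  have h1 : ∀ x ∈ {x : A → ℝ | vecMean x = vecMean x₀},
      Set.indicator {x | ε ≤ relError x₀ x} 1 x ≤ 0 + (ε * R)⁻¹ ^ 2 * spread x := by
    intro x hx
    rw [zero_add]
    by_cases hB : x ∈ {x | ε ≤ relError x₀ x}
    · rw [Set.indicator_of_mem hB]
      have hB' : ε * R ≤ ‖WithLp.toLp 2 fun i => x i - vecMean x₀‖ :=
        (le_div_iff₀ hR).1 hB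
      have hs : ‖WithLp.toLp 2 fun i => x i - vecMean x₀‖ ^ 2 = spread x := by
        rw [EuclideanSpace.real_norm_sq_eq, spread, hx]
      have h2 : (ε * R) ^ 2 ≤ spread x := hs ▸ pow_le_pow_left₀ (by positivity) hB' 2
      rw [inv_pow, Pi.one_apply, inv_mul_eq_div]
      exact (one_le_div₀ (by positivity)).2 h2
    · rw [Set.indicator_of_notMem hB]
      exact mul_nonneg (sq_nonneg _) (spread_nonneg x)
  have h2 := pairOp_iterate_mono_on (pairLaw G μ)
    (S := {x : A → ℝ | vecMean x = vecMean x₀})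
    (fun i j x hx => (vecMean_pairAverage i j x).trans hx) t h1 x₀ rfl
  rw [pairOp_iterate_affine, zero_add] at h2
  refine h2.trans ?_
  have h3 : (pairOp (pairLaw G μ))^[t] spread x₀ ≤ ε ^ 3 * R ^ 2 :=
    (pairOp_iterate_spread_le _ hγ h t x₀).trans
      (mul_le_mul ht (spread_le x₀) (spread_nonneg x₀) (by positivity))
  refine (mul_le_mul_of_nonneg_left h3 (sq_nonneg _)).trans_eq ?_
  field_simp

/-- If the relative error is below `ε` with probability at least `1 - ε`, its mean is at most
`ε + (1 - ε) ε`, as it never exceeds `1`; the mean is at least the relative norm of the expected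
vector. -/
theorem pow_le_of_toOuterMeasure_relError_le {δ : ℝ} (hδ : δ < 1) {x₀ : A → ℝ} (hx₀ : x₀ ≠ 0)
    (hmean : vecMean x₀ = 0)
    (h : pairEnergy (pairLaw G μ) x₀ ≤ 2 * δ * (x₀ ⬝ᵥ x₀)) {ε : ℝ} (hε : 0 < ε) (hε' : ε ≤ 1)
    {t : ℕ} (ht : (gossipLaw G μ x₀ t).toOuterMeasure {x | ε ≤ relError x₀ x}
      ≤ ENNReal.ofReal ε) :
    (1 - δ) ^ t ≤ ε * (2 - ε) := by
  rw [toOuterMeasure_gossipLaw, ENNReal.ofReal_le_ofReal_iff hε.le] at ht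
  have hR : 0 < ‖WithLp.toLp 2 x₀‖ := by simpa using hx₀
  have hpow := pow_mul_norm_le_norm_meanStep_iterate (pairLaw G μ) hδ hx₀ h t
  set R := ‖WithLp.toLp 2 x₀‖ with hRdef
  set y := (meanStep (pairLaw G μ))^[t] x₀ with hy
  have hY : 0 < ‖WithLp.toLp 2 y‖ := lt_of_lt_of_le (by have := sub_pos.2 hδ; positivity) hpow
  set Y := ‖WithLp.toLp 2 y‖ with hYdef
  have h1 : ∀ x ∈ {x : A → ℝ | ‖WithLp.toLp 2 x‖ ≤ R},
      y ⬝ᵥ x ≤ Y * R * ε + Y * R * (1 - ε) * Set.indicator {x | ε ≤ relError x₀ x} 1 x := by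
    intro x hx
    refine (dotProduct_le_norm_mul_norm y x).trans ?_
    have hx' : ‖WithLp.toLp 2 x‖ ≤ R := hx
    by_cases hB : x ∈ {x | ε ≤ relError x₀ x}
    · rw [Set.indicator_of_mem hB, Pi.one_apply]
      nlinarith
    · rw [Set.indicator_of_notMem hB]
      have hB' : ‖WithLp.toLp 2 x‖ < ε * R := by
        have h0 := not_le.1 (show ¬ ε ≤ relError x₀ x from hB)
        simp only [relError, hmean, sub_zero] at h0
        exact (div_lt_iff₀ hR).1 h0
      nlinarith
  have h2 := pairOp_iterate_mono_on (pairLaw G μ) (S := {x : A → ℝ | ‖WithLp.toLp 2 x‖ ≤ R})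
    (fun i j x hx => (norm_pairAverage_le i j x).trans hx) t h1 x₀ hRdef.ge
  rw [pairOp_iterate_affine, pairOp_iterate_dotProduct] at h2
  have h3 : (meanStep (pairLaw G μ))^[t] y ⬝ᵥ x₀ = Y ^ 2 := by
    rw [← dotProduct_meanStep_iterate_comm, ← hy, norm_toLp_sq]
  simp only [h3] at h2
  have h4 : Y * Y ≤ Y * (R * (ε * (2 - ε))) := by
    have : Y * R * (1 - ε) * (pairOp (pairLaw G μ))^[t]
        (Set.indicator {x | ε ≤ relError x₀ x} 1) x₀ ≤ Y * R * (1 - ε) * ε :=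
      mul_le_mul_of_nonneg_left ht (mul_nonneg (by positivity) (by linarith))
    nlinarith
  have h5 := le_of_mul_le_mul_left h4 hY
  refine le_of_mul_le_mul_right (hpow.trans (h5.trans_eq (mul_comm _ _))) hR

end Gossip

/-! ### Locations and choices -/

section Choices

variable {A V : Type*} [Fintype A]

section Locations

variable [DecidableEq A] [Fintype V]

omit [DecidableEq A] in
theorem toReal_locationLaw (μ : A → PMF V) (l : A → V) :
    (locationLaw μ l).toReal = ∏ i, (μ i (l i)).toReal := by
  rw [← ENNReal.toReal_prod]
  rfl

theorem sum_locationLaw_prod (μ : A → PMF V) (φ : A → V → ℝ) :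
    ∑ l, (locationLaw μ l).toReal * ∏ i, φ i (l i) = ∏ i, ∑ v, (μ i v).toReal * φ i v := by
  simp only [Fintype.prod_sum, toReal_locationLaw, Finset.prod_mul_distrib]

theorem sum_locationLaw_mul_one (μ : A → PMF V) (k : A) (f : V → ℝ) :
    ∑ l, (locationLaw μ l).toReal * f (l k) = ∑ v, (μ k v).toReal * f v := by
  have h := sum_locationLaw_prod μ fun i v => if i = k then f v else 1
  rw [Fintype.prod_eq_single k fun i hi => by simp [hi, sum_toReal_eq_one]] at h
  simpa using h

theorem sum_locationLaw_mul_two (μ : A → PMF V) {k k' : A} (hk : k ≠ k') (f g : V → ℝ) :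
    ∑ l, (locationLaw μ l).toReal * (f (l k) * g (l k')) =
      (∑ v, (μ k v).toReal * f v) * ∑ v, (μ k' v).toReal * g v := by
  have h := sum_locationLaw_prod μ fun i v => if i = k then f v else if i = k' then g v else 1
  rw [Fintype.prod_eq_mul k k' hk fun i hi => by simp [hi.1, hi.2, sum_toReal_eq_one]] at h
  have h2 : ∀ l : A → V, (∏ i, if i = k then f (l i) else if i = k' then g (l i) else 1) =
      f (l k) * g (l k') := fun l => by
    rw [Fintype.prod_eq_mul k k' hk fun i hi => by simp [hi.1, hi.2]]
    simp [hk.symm]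
  simpa [h2, hk.symm] using h

end Locations

variable (G : SimpleGraph V)

theorem chooseNeighbor_of_mem {l : A → V} {i j : A} (h : j ∈ gossipNeighbors G l i) :
    (chooseNeighbor G l i j).toReal = ((gossipNeighbors G l i).card : ℝ)⁻¹ := by
  have h' : (gossipNeighbors G l i).Nonempty := ⟨j, h⟩
  rw [chooseNeighbor, dif_pos h', PMF.uniformOfFinset_apply_of_mem h' h]
  simp

theorem chooseNeighbor_of_notMem {l : A → V} {i j : A} (hij : j ≠ i)
    (h : j ∉ gossipNeighbors G l i) : (chooseNeighbor G l i j).toReal = 0 := by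
  rw [chooseNeighbor]
  split_ifs with h'
  · rw [PMF.uniformOfFinset_apply_of_notMem h' h, ENNReal.toReal_zero]
  · simp [PMF.pure_apply, hij]

theorem chooseNeighbor_le_one (l : A → V) (i j : A) : (chooseNeighbor G l i j).toReal ≤ 1 :=
  ENNReal.toReal_le_of_le_ofReal zero_le_one (by simpa using PMF.coe_le_one _ j)

variable [DecidableEq A] [Nonempty A] [Fintype V] (μ : A → PMF V)

theorem toReal_pairLaw (i j : A) :
    (pairLaw G μ (i, j)).toReal =
      (Fintype.card A : ℝ)⁻¹ *
        ∑ l, (locationLaw μ l).toReal * (chooseNeighbor G l i j).toReal := by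
  have h1 : ∀ (l : A → V) (i' : A),
      (chooseNeighbor G l i').map (fun j => (i', j)) (i, j) =
        if i' = i then chooseNeighbor G l i j else 0 := by
    intro l i'
    rw [PMF.map_apply]
    split_ifs with h
    · subst h
      rw [tsum_eq_single j (fun b hb => by simp [hb.symm])]
      simp
    · simp [Ne.symm h]
  have h2 : pairLaw G μ (i, j) =
      ∑ l, locationLaw μ l * ((Fintype.card A : ℝ≥0∞)⁻¹ * chooseNeighbor G l i j) := by
    simp only [pairLaw, PMF.bind_apply, tsum_fintype, h1, PMF.uniformOfFintype_apply]
    simp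
  rw [h2, ENNReal.toReal_sum fun l _ => ENNReal.mul_ne_top (PMF.apply_ne_top _ _)
    (ENNReal.mul_ne_top (by simp) (PMF.apply_ne_top _ _)), Finset.mul_sum]
  refine Finset.sum_congr rfl fun l _ => ?_
  simp only [ENNReal.toReal_mul, ENNReal.toReal_inv, ENNReal.toReal_natCast]
  ring

theorem pairEnergy_pairLaw (x : A → ℝ) :
    pairEnergy (pairLaw G μ) x = (Fintype.card A : ℝ)⁻¹ *
      ∑ l, (locationLaw μ l).toReal *
        ∑ i, ∑ j, (chooseNeighbor G l i j).toReal * (x i - x j) ^ 2 := by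
  calc pairEnergy (pairLaw G μ) x
      = ∑ i, ∑ j, ∑ l, (Fintype.card A : ℝ)⁻¹ * ((locationLaw μ l).toReal *
          ((chooseNeighbor G l i j).toReal * (x i - x j) ^ 2)) := by
        simp only [pairEnergy, Fintype.sum_prod_type, toReal_pairLaw, Finset.mul_sum,
          Finset.sum_mul, mul_assoc]
    _ = ∑ i, ∑ l, ∑ j, (Fintype.card A : ℝ)⁻¹ * ((locationLaw μ l).toReal *
          ((chooseNeighbor G l i j).toReal * (x i - x j) ^ 2)) :=
        Finset.sum_congr rfl fun i _ => Finset.sum_comm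
    _ = _ := by
        rw [Finset.sum_comm]
        simp only [Finset.mul_sum]

end Choices

/-! ### Static and mobile agents on the torus -/

section Torus

open Classical in
/-- The vertices of the torus within distance one of `v`. -/
noncomputable def closedNbhd {L : ℕ} (v : Fin L × Fin L) : Finset (Fin L × Fin L) :=
  Finset.univ.filter fun w => v = w ∨ (torusGraph L).Adj v w

theorem mem_closedNbhd {L : ℕ} {v w : Fin L × Fin L} :
    w ∈ closedNbhd v ↔ v = w ∨ (torusGraph L).Adj v w := by
  simp [closedNbhd]

theorem mem_closedNbhd_comm {L : ℕ} {v w : Fin L × Fin L} :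
    w ∈ closedNbhd v ↔ v ∈ closedNbhd w := by
  rw [mem_closedNbhd, mem_closedNbhd, SimpleGraph.adj_comm, eq_comm]

theorem card_closedNbhd_le {L : ℕ} (hL : 2 ≤ L) (v : Fin L × Fin L) :
    (closedNbhd v).card ≤ 5 := by
  classical
  obtain ⟨k, rfl⟩ := Nat.exists_eq_add_of_le' hL
  have h : closedNbhd v ⊆
      {v, (v.1 - 1, v.2), (v.1 + 1, v.2), (v.1, v.2 - 1), (v.1, v.2 + 1)} := by
    intro w hw
    have hadj : ∀ a b : Fin (k + 2), (SimpleGraph.cycleGraph (k + 2)).Adj a b →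
        b = a - 1 ∨ b = a + 1 := by
      intro a b hab
      rw [SimpleGraph.cycleGraph_adj] at hab
      rcases hab with h | h
      · left; rw [← h]; abel
      · right; rw [← h]; abel
    rw [mem_closedNbhd, torusGraph, SimpleGraph.boxProd_adj] at hw
    obtain ⟨w1, w2⟩ := w
    obtain ⟨v1, v2⟩ := v
    simp only [Finset.mem_insert, Finset.mem_singleton, Prod.mk.injEq] at hw ⊢
    rcases hw with h | ⟨h, h'⟩ | ⟨h, h'⟩
    · exact .inl ⟨h.1.symm, h.2.symm⟩
    · rcases hadj _ _ h with h | h <;> simp [h, h']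
    · rcases hadj _ _ h with h | h <;> simp [h, h']
  exact (Finset.card_le_card h).trans Finset.card_le_five

variable {L m : ℕ} [NeZero L]

theorem apply_inl_of_locationLaw_ne_zero {l : (Fin L × Fin L) ⊕ Fin m → Fin L × Fin L}
    (hl : (locationLaw (staticPlusMobile L m) l).toReal ≠ 0) (v : Fin L × Fin L) :
    l (Sum.inl v) = v := by
  rw [toReal_locationLaw, Finset.prod_ne_zero_iff] at hl
  have := hl (Sum.inl v) (Finset.mem_univ _)
  by_contra h
  exact this (by simp [staticPlusMobile, PMF.pure_apply, h])

theorem sum_staticPlusMobile_inr (k : Fin m) (f : Fin L × Fin L → ℝ) :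
    ∑ v, (staticPlusMobile L m (Sum.inr k) v).toReal * f v = ((L : ℝ) ^ 2)⁻¹ * ∑ v, f v := by
  simp [staticPlusMobile, Finset.mul_sum, sq]

/-- The number of mobile agents within distance one of `v`. -/
noncomputable def mobileCount (l : (Fin L × Fin L) ⊕ Fin m → Fin L × Fin L)
    (v : Fin L × Fin L) : ℕ :=
  (Finset.univ.filter fun k : Fin m => l (Sum.inr k) ∈ closedNbhd v).card

omit [NeZero L] in
theorem card_gossipNeighbors_inl_le (hL : 2 ≤ L)
    {l : (Fin L × Fin L) ⊕ Fin m → Fin L × Fin L} (hl : ∀ v, l (Sum.inl v) = v)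
    (v : Fin L × Fin L) :
    (gossipNeighbors (torusGraph L) l (Sum.inl v)).card ≤ 5 + mobileCount l v := by
  classical
  have h : gossipNeighbors (torusGraph L) l (Sum.inl v) ⊆
      (closedNbhd v).disjSum
        (Finset.univ.filter fun k : Fin m => l (Sum.inr k) ∈ closedNbhd v) := by
    intro j hj
    simp only [gossipNeighbors, Finset.mem_filter, hl] at hj
    rcases j with w | k
    · simpa [mem_closedNbhd, hl] using hj.2.2
    · simpa [mem_closedNbhd] using hj.2.2
  refine (Finset.card_le_card h).trans ?_
  rw [Finset.card_disjSum]
  exact Nat.add_le_add_right (card_closedNbhd_le hL v) _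

omit [NeZero L] in
theorem inr_mem_gossipNeighbors_inl {l : (Fin L × Fin L) ⊕ Fin m → Fin L × Fin L}
    (hl : ∀ v, l (Sum.inl v) = v) {v : Fin L × Fin L} {k : Fin m} :
    Sum.inr k ∈ gossipNeighbors (torusGraph L) l (Sum.inl v) ↔
      l (Sum.inr k) ∈ closedNbhd v := by
  simp [gossipNeighbors, mem_closedNbhd, hl]

omit [NeZero L] in
/-- A lower bound that is linear in the numbers of agents near `v`, so that its expectation is
explicit; `16 / 121` is `2 / 11 - 6 / 121`, where `6` bounds the number of static agents near `v`
and the agent `k`. -/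
theorem le_chooseNeighbor_inl_inr (hL : 2 ≤ L)
    {l : (Fin L × Fin L) ⊕ Fin m → Fin L × Fin L} (hl : ∀ v, l (Sum.inl v) = v)
    (v : Fin L × Fin L) (k : Fin m) :
    (16 / 121 : ℝ) * (if l (Sum.inr k) = v then 1 else 0) -
        1 / 121 * ∑ k' ∈ Finset.univ.erase k, (if l (Sum.inr k) = v then 1 else 0) *
          (if l (Sum.inr k') ∈ closedNbhd v then 1 else 0) ≤
      (chooseNeighbor (torusGraph L) l (Sum.inl v) (Sum.inr k)).toReal := by
  by_cases hk : l (Sum.inr k) = v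
  swap
  · simp [hk]
  have hmem : l (Sum.inr k) ∈ closedNbhd v := mem_closedNbhd.2 (.inl hk.symm)
  have hj := (inr_mem_gossipNeighbors_inl hl).2 hmem
  rw [chooseNeighbor_of_mem _ hj]
  have hpos : (0 : ℝ) < (gossipNeighbors (torusGraph L) l (Sum.inl v)).card := by
    exact_mod_cast Finset.card_pos.2 ⟨_, hj⟩
  have hle : ((gossipNeighbors (torusGraph L) l (Sum.inl v)).card : ℝ) ≤ 5 + mobileCount l v := by
    exact_mod_cast card_gossipNeighbors_inl_le hL hl v
  have hcount : (mobileCount l v : ℝ) = 1 + ∑ k' ∈ Finset.univ.erase k,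
      (if l (Sum.inr k') ∈ closedNbhd v then 1 else 0) := by
    have h0 : (mobileCount l v : ℝ) = ∑ k' : Fin m,
        (if l (Sum.inr k') ∈ closedNbhd v then 1 else 0) := by
      rw [Finset.sum_boole]
      simp only [mobileCount]
    rw [h0, ← Finset.add_sum_erase _ _ (Finset.mem_univ k), if_pos hmem]
  simp only [hk, if_true, one_mul, mul_one]
  set s : ℝ := ((gossipNeighbors (torusGraph L) l (Sum.inl v)).card : ℝ)
  -- the tangent line of the convex function `s ↦ 1 / s` at `s = 11`
  have htan : 2 / 11 - s / 121 ≤ s⁻¹ := by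
    rw [← one_div, le_div_iff₀ hpos]
    nlinarith [sq_nonneg (s - 11)]
  linarith

/-- Every static agent wakes up and chooses a given mobile agent with probability of order
`1 / n ^ 2`. -/
theorem le_pairLaw_inl_inr (hL : 2 ≤ L) (hm : m ≤ L ^ 2) (v : Fin L × Fin L) (k : Fin m) :
    1 / (22 * ((L : ℝ) ^ 2) ^ 2) ≤
      (pairLaw (torusGraph L) (staticPlusMobile L m) (Sum.inl v, Sum.inr k)).toReal := by
  set μ := staticPlusMobile L m
  have hn : (0 : ℝ) < (L : ℝ) ^ 2 := by positivity
  have hmn : (m : ℝ) ≤ (L : ℝ) ^ 2 := by exact_mod_cast hm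
  have h1 : ∑ l, (locationLaw μ l).toReal * (if l (Sum.inr k) = v then (1 : ℝ) else 0) =
      ((L : ℝ) ^ 2)⁻¹ := by
    rw [sum_locationLaw_mul_one μ (Sum.inr k) fun w => if w = v then (1 : ℝ) else 0,
      sum_staticPlusMobile_inr]
    simp
  have h2 : ∀ k' ∈ Finset.univ.erase k,
      ∑ l, (locationLaw μ l).toReal * ((if l (Sum.inr k) = v then (1 : ℝ) else 0) *
        (if l (Sum.inr k') ∈ closedNbhd v then 1 else 0)) ≤
      ((L : ℝ) ^ 2)⁻¹ * (((L : ℝ) ^ 2)⁻¹ * 5) := by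
    intro k' hk'
    have hne : (Sum.inr k : (Fin L × Fin L) ⊕ Fin m) ≠ Sum.inr k' := by
      simpa using (Finset.ne_of_mem_erase hk').symm
    rw [sum_locationLaw_mul_two μ hne (fun w => if w = v then (1 : ℝ) else 0)
      (fun w => if w ∈ closedNbhd v then (1 : ℝ) else 0), sum_staticPlusMobile_inr,
      sum_staticPlusMobile_inr]
    have : ((closedNbhd v).card : ℝ) ≤ 5 := by exact_mod_cast card_closedNbhd_le hL v
    simp only [Finset.sum_ite_eq', Finset.mem_univ, if_true, mul_one, Finset.sum_boole,
      Finset.filter_mem_eq_inter, Finset.univ_inter]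
    gcongr
  have h3 : ((L : ℝ) ^ 2)⁻¹ * (1 / 11) ≤
      ∑ l, (locationLaw μ l).toReal *
        (chooseNeighbor (torusGraph L) l (Sum.inl v) (Sum.inr k)).toReal := by
    have h4 : ∑ l, (locationLaw μ l).toReal *
        ((16 / 121 : ℝ) * (if l (Sum.inr k) = v then 1 else 0) -
        1 / 121 * ∑ k' ∈ Finset.univ.erase k, (if l (Sum.inr k) = v then 1 else 0) *
          (if l (Sum.inr k') ∈ closedNbhd v then 1 else 0)) ≤
        ∑ l, (locationLaw μ l).toReal *
          (chooseNeighbor (torusGraph L) l (Sum.inl v) (Sum.inr k)).toReal := by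
      refine Finset.sum_le_sum fun l _ => ?_
      by_cases hl : (locationLaw μ l).toReal = 0
      · simp [hl]
      · exact mul_le_mul_of_nonneg_left
          (le_chooseNeighbor_inl_inr hL (apply_inl_of_locationLaw_ne_zero hl) v k)
          ENNReal.toReal_nonneg
    refine le_trans ?_ h4
    have h5 : ∑ l, (locationLaw μ l).toReal * ∑ k' ∈ Finset.univ.erase k,
        (if l (Sum.inr k) = v then (1 : ℝ) else 0) *
          (if l (Sum.inr k') ∈ closedNbhd v then 1 else 0) ≤ ((L : ℝ) ^ 2)⁻¹ * 5 := by
      simp only [Finset.mul_sum]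
      rw [Finset.sum_comm]
      refine (Finset.sum_le_sum h2).trans ?_
      rw [Finset.sum_const, nsmul_eq_mul]
      have hc : (((Finset.univ.erase k).card : ℕ) : ℝ) ≤ (L : ℝ) ^ 2 := by
        refine le_trans ?_ hmn
        exact_mod_cast (Finset.card_le_univ _).trans_eq (Fintype.card_fin m)
      calc _ ≤ (L : ℝ) ^ 2 * (((L : ℝ) ^ 2)⁻¹ * (((L : ℝ) ^ 2)⁻¹ * 5)) := by gcongr
        _ = _ := by field_simp
    simp only [mul_sub, Finset.sum_sub_distrib, mul_left_comm _ (16 / 121 : ℝ),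
      mul_left_comm _ (1 / 121 : ℝ)]
    rw [← Finset.mul_sum, ← Finset.mul_sum, h1]
    linarith
  rw [toReal_pairLaw]
  have hcard : (Fintype.card ((Fin L × Fin L) ⊕ Fin m) : ℝ) ≤ 2 * (L : ℝ) ^ 2 := by
    simp only [Fintype.card_sum, Fintype.card_prod, Fintype.card_fin]
    push_cast
    nlinarith
  calc 1 / (22 * ((L : ℝ) ^ 2) ^ 2) = (2 * (L : ℝ) ^ 2)⁻¹ * (((L : ℝ) ^ 2)⁻¹ * (1 / 11)) := by
        field_simp; norm_num
    _ ≤ _ := by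
        refine mul_le_mul ?_ h3 (by positivity) (by positivity)
        exact inv_anti₀ (by exact_mod_cast Fintype.card_pos) hcard

/-- The Poincaré inequality of the complete bipartite graph, with the smaller side size as
spectral gap. -/
theorem card_mul_spread_le {B C : Type*} [Fintype B] [Fintype C] [Nonempty B]
    (h : Fintype.card C ≤ Fintype.card B) (x : B ⊕ C → ℝ) :
    (Fintype.card C : ℝ) * spread x ≤ ∑ b, ∑ c, (x (Sum.inl b) - x (Sum.inr c)) ^ 2 := by
  set a := vecMean x with ha
  have hN : ((Fintype.card (B ⊕ C) : ℕ) : ℝ) ≠ 0 := by exact_mod_cast Fintype.card_ne_zero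
  have h0 : ∑ b, (x (Sum.inl b) - a) + ∑ c, (x (Sum.inr c) - a) = 0 := by
    rw [← Fintype.sum_sum_type fun i => x i - a, Finset.sum_sub_distrib, ha, vecMean]
    simp only [Finset.sum_const, Finset.card_univ, nsmul_eq_mul]
    field_simp
    ring
  have h1 : ∀ b c, (x (Sum.inl b) - x (Sum.inr c)) ^ 2 = (x (Sum.inl b) - a) ^ 2 +
      (x (Sum.inr c) - a) ^ 2 - 2 * ((x (Sum.inl b) - a) * (x (Sum.inr c) - a)) :=
    fun b c => by ring
  have h2 : 0 ≤ ∑ c, (x (Sum.inr c) - a) ^ 2 := Finset.sum_nonneg fun _ _ => sq_nonneg _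
  have h3 : (Fintype.card C : ℝ) ≤ Fintype.card B := by exact_mod_cast h
  have h4 : ∑ b, ∑ c, (x (Sum.inl b) - x (Sum.inr c)) ^ 2 =
      Fintype.card C * ∑ b, (x (Sum.inl b) - a) ^ 2 +
        Fintype.card B * ∑ c, (x (Sum.inr c) - a) ^ 2 -
        2 * ((∑ b, (x (Sum.inl b) - a)) * ∑ c, (x (Sum.inr c) - a)) := by
    rw [Finset.sum_mul_sum]
    simp only [h1, Finset.sum_add_distrib, Finset.sum_sub_distrib (f := fun _ => _ + _),
      Finset.sum_const, Finset.card_univ, nsmul_eq_mul, ← Finset.mul_sum]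
  rw [h4, eq_neg_of_add_eq_zero_right h0, spread, Fintype.sum_sum_type, ← ha]
  nlinarith [sq_nonneg (∑ b, (x (Sum.inl b) - a)), mul_le_mul_of_nonneg_right h3 h2]

theorem spread_le_pairEnergy (hL : 2 ≤ L) (hm : m ≤ L ^ 2)
    (x : (Fin L × Fin L) ⊕ Fin m → ℝ) :
    2 * (m / (44 * ((L : ℝ) ^ 2) ^ 2)) * spread x ≤
      pairEnergy (pairLaw (torusGraph L) (staticPlusMobile L m)) x := by
  have h1 := card_mul_spread_le (by simpa [sq] using hm) x
  rw [Fintype.card_fin] at h1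
  have h2 : (1 / (22 * ((L : ℝ) ^ 2) ^ 2)) * ∑ b, ∑ c, (x (Sum.inl b) - x (Sum.inr c)) ^ 2 ≤
      pairEnergy (pairLaw (torusGraph L) (staticPlusMobile L m)) x := by
    have h3 : ∀ F : ((Fin L × Fin L) ⊕ Fin m) × ((Fin L × Fin L) ⊕ Fin m) → ℝ,
        ∑ p, F p = ∑ i, ∑ j, F (i, j) := fun F => Fintype.sum_prod_type F
    rw [pairEnergy, h3, Fintype.sum_sum_type, Finset.mul_sum]
    refine le_add_of_le_of_nonneg (Finset.sum_le_sum fun v _ => ?_)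
      (Finset.sum_nonneg fun _ _ => Finset.sum_nonneg fun _ _ =>
        mul_nonneg ENNReal.toReal_nonneg (sq_nonneg _))
    rw [Fintype.sum_sum_type, Finset.mul_sum]
    refine le_add_of_nonneg_of_le (Finset.sum_nonneg fun _ _ =>
        mul_nonneg ENNReal.toReal_nonneg (sq_nonneg _)) (Finset.sum_le_sum fun k _ => ?_)
    exact mul_le_mul_of_nonneg_right (le_pairLaw_inl_inr hL hm v k) (sq_nonneg _)
  refine le_trans (le_of_eq_of_le ?_ (mul_le_mul_of_nonneg_left h1 ?_)) h2
  · ring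
  · positivity

end Torus

/-! ### A slowly varying function on the torus -/

section TestVector

/-- The real or the imaginary part of the first character of the cycle, whichever is larger. The
last bound improves on the preceding one for `L = 2` only. -/
theorem exists_slow_function_on_cycle {L : ℕ} (hL : 2 ≤ L) :
    ∃ f : Fin L → ℝ, ∑ a, f a = 0 ∧ (∀ a, |f a| ≤ 1) ∧
      (∀ a b, (SimpleGraph.cycleGraph L).Adj a b → (f a - f b) ^ 2 ≤ 40 / (L : ℝ) ^ 2) ∧
      (L : ℝ) / 2 ≤ ∑ a, f a ^ 2 ∧ 4 ≤ L * ∑ a, f a ^ 2 := by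
  have hL0 : L ≠ 0 := by omega
  have hLR : (2 : ℝ) ≤ L := by exact_mod_cast hL
  set ζ : ℂ := Complex.exp (2 * Real.pi * Complex.I / L) with hζ
  have hprim : IsPrimitiveRoot ζ L := Complex.isPrimitiveRoot_exp L hL0
  have hnorm : ‖ζ‖ = 1 := hprim.norm'_eq_one hL0
  set e : Fin L → ℂ := fun a => ζ ^ (a : ℕ) with he
  have hsum : ∑ a, e a = 0 := by
    rw [Fin.sum_univ_eq_sum_range (fun i => ζ ^ i) L, hprim.geom_sum_eq_zero (by omega)]
  have hen : ∀ a, ‖e a‖ = 1 := fun a => by simp [he, hnorm]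
  have hζ1 : ‖ζ - 1‖ ≤ 2 * Real.pi / L := by
    have h := Real.norm_exp_I_mul_ofReal_sub_one_le (x := 2 * Real.pi / L)
    rw [Real.norm_of_nonneg (by positivity)] at h
    convert h using 4
    push_cast
    ring
  have hstep : ∀ a b, (SimpleGraph.cycleGraph L).Adj a b →
      ‖e a - e b‖ ^ 2 ≤ 40 / (L : ℝ) ^ 2 := by
    have hsucc : ∀ a b : Fin L, (a - b).val = 1 → ‖e a - e b‖ ≤ 2 * Real.pi / L := by
      intro a b hab
      have ha : e a = e b * ζ := by
        have : NeZero L := ⟨hL0⟩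
        have h1 : (a : ℕ) = ((b : ℕ) + 1) % L := by
          conv_lhs => rw [← sub_add_cancel a b, Fin.val_add, hab, add_comm]
        simp only [he, h1]
        rw [← pow_succ, ← pow_eq_pow_mod _ hprim.pow_eq_one]
      rw [ha, ← mul_sub_one, norm_mul, hen, one_mul]
      exact hζ1
    intro a b hab
    have h : ‖e a - e b‖ ≤ 2 * Real.pi / L := by
      rcases SimpleGraph.cycleGraph_adj'.1 hab with h | h
      · exact hsucc a b h
      · rw [norm_sub_rev]; exact hsucc b a h
    calc ‖e a - e b‖ ^ 2 ≤ (2 * Real.pi / L) ^ 2 := pow_le_pow_left₀ (norm_nonneg _) h 2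
      _ = (2 * Real.pi) ^ 2 / (L : ℝ) ^ 2 := div_pow _ _ _
      _ ≤ 40 / (L : ℝ) ^ 2 := by
        gcongr
        nlinarith [Real.pi_lt_d2, Real.pi_pos]
  have hsq : ∑ a, (e a).re ^ 2 + ∑ a, (e a).im ^ 2 = L := by
    rw [← Finset.sum_add_distrib]
    have : ∀ a, (e a).re ^ 2 + (e a).im ^ 2 = 1 := fun a => by
      rw [sq, sq, ← Complex.normSq_apply, Complex.normSq_eq_norm_sq, hen, one_pow]
    simp [this]
  have hfour : ∀ s : ℝ, (L : ℝ) / 2 ≤ s → (L = 2 → 2 ≤ s) → 4 ≤ L * s := by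
    intro s hs hs2
    rcases hL.eq_or_lt with h | h
    · have := hs2 h.symm
      nlinarith
    · have : (3 : ℝ) ≤ L := by exact_mod_cast h
      nlinarith
  rcases le_or_gt (∑ a, (e a).im ^ 2) (∑ a, (e a).re ^ 2) with hle | hlt
  · refine ⟨fun a => (e a).re, by simpa using congrArg Complex.re hsum,
      fun a => (Complex.abs_re_le_norm _).trans (hen a).le, fun a b hab => ?_, by linarith,
      hfour _ (by linarith) ?_⟩
    · refine le_trans ?_ (hstep a b hab)
      rw [← Complex.sub_re, ← sq_abs]
      exact pow_le_pow_left₀ (abs_nonneg _) (Complex.abs_re_le_norm _) 2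
    · rintro rfl
      have : ζ = -1 := by simpa using hprim.eq_neg_one_of_two_right
      simp [he, this, Fin.sum_univ_two]
      norm_num
  · refine ⟨fun a => (e a).im, by simpa using congrArg Complex.im hsum,
      fun a => (Complex.abs_im_le_norm _).trans (hen a).le, fun a b hab => ?_, by linarith,
      hfour _ (by linarith) ?_⟩
    · refine le_trans ?_ (hstep a b hab)
      rw [← Complex.sub_im, ← sq_abs]
      exact pow_le_pow_left₀ (abs_nonneg _) (Complex.abs_im_le_norm _) 2
    · rintro rfl
      have : ζ = -1 := by simpa using hprim.eq_neg_one_of_two_right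
      simp [he, this, Fin.sum_univ_two] at hlt
      norm_num at hlt

variable {L m : ℕ}

/-- The vector of values with value `f v.1` at the static agent `v` and `0` at mobile agents. -/
def staticVector (m : ℕ) (f : Fin L → ℝ) : (Fin L × Fin L) ⊕ Fin m → ℝ :=
  Sum.elim (fun v => f v.1) 0

theorem staticVector_dotProduct_self (f : Fin L → ℝ) :
    staticVector m f ⬝ᵥ staticVector m f = L * ∑ a, f a ^ 2 := by
  simp [dotProduct, staticVector, Fintype.sum_prod_type, Finset.mul_sum, sq]

theorem vecMean_staticVector {f : Fin L → ℝ} (hf : ∑ a, f a = 0) :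
    vecMean (staticVector m f) = 0 := by
  simp [vecMean, staticVector, Fintype.sum_prod_type, ← Finset.mul_sum, hf]

theorem abs_staticVector_le {f : Fin L → ℝ} (hf : ∀ a, |f a| ≤ 1)
    (i : (Fin L × Fin L) ⊕ Fin m) : |staticVector m f i| ≤ 1 := by
  rcases i with v | k
  · exact hf _
  · simp [staticVector]

theorem sum_chooseNeighbor_mul_le (hL : 2 ≤ L) {f : Fin L → ℝ} (hf : ∀ a, |f a| ≤ 1)
    (hadj : ∀ a b, (SimpleGraph.cycleGraph L).Adj a b → (f a - f b) ^ 2 ≤ 40 / (L : ℝ) ^ 2)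
    {l : (Fin L × Fin L) ⊕ Fin m → Fin L × Fin L} (hl : ∀ v, l (Sum.inl v) = v) :
    ∑ i, ∑ j, (chooseNeighbor (torusGraph L) l i j).toReal *
      (staticVector m f i - staticVector m f j) ^ 2 ≤ 40 + 6 * m := by
  set c := fun i j => (chooseNeighbor (torusGraph L) l i j).toReal with hc
  have hc0 : ∀ i j, 0 ≤ c i j := fun _ _ => ENNReal.toReal_nonneg
  have hc1 : ∀ i, ∑ j, c i j = 1 := fun i => sum_toReal_eq_one _
  have hf2 : ∀ a, f a ^ 2 ≤ 1 := fun a => (sq_le_one_iff_abs_le_one _).2 (hf a)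
  have hn : (0 : ℝ) < (L : ℝ) ^ 2 := by positivity
  have hstatic : ∀ v, ∑ w, c (Sum.inl v) (Sum.inl w) * (f v.1 - f w.1) ^ 2 ≤
      40 / (L : ℝ) ^ 2 := by
    intro v
    have h1 : ∀ w, c (Sum.inl v) (Sum.inl w) * (f v.1 - f w.1) ^ 2 ≤
        c (Sum.inl v) (Sum.inl w) * (40 / (L : ℝ) ^ 2) := by
      intro w
      by_cases hw : Sum.inl w ∈ gossipNeighbors (torusGraph L) l (Sum.inl v)
      · refine mul_le_mul_of_nonneg_left ?_ (hc0 _ _)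
        simp only [gossipNeighbors, Finset.mem_filter, hl, torusGraph,
          SimpleGraph.boxProd_adj] at hw
        rcases hw.2.2 with h | h | h
        · rw [h, sub_self, sq, zero_mul]; positivity
        · exact hadj _ _ h.1
        · rw [h.2, sub_self, sq, zero_mul]; positivity
      · by_cases hvw : w = v
        · rw [hvw, sub_self, sq, zero_mul, mul_zero]
          exact mul_nonneg (hc0 _ _) (by positivity)
        · have : c (Sum.inl v) (Sum.inl w) = 0 :=
            chooseNeighbor_of_notMem _ (by simpa using hvw) hw
          simp [this]
    refine (Finset.sum_le_sum fun w _ => h1 w).trans ?_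
    rw [← Finset.sum_mul]
    refine mul_le_of_le_one_left (by positivity) ?_
    rw [← hc1 (Sum.inl v), Fintype.sum_sum_type]
    exact le_add_of_nonneg_right (Finset.sum_nonneg fun _ _ => hc0 _ _)
  have hmobile : ∀ v k, c (Sum.inl v) (Sum.inr k) * f v.1 ^ 2 ≤
      if v ∈ closedNbhd (l (Sum.inr k)) then 1 else 0 := by
    intro v k
    split_ifs with h
    · exact mul_le_one₀ (chooseNeighbor_le_one _ _ _ _) (sq_nonneg _) (hf2 _)
    · rw [mem_closedNbhd_comm, ← inr_mem_gossipNeighbors_inl hl] at h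
      have : c (Sum.inl v) (Sum.inr k) = 0 := chooseNeighbor_of_notMem _ (by simp) h
      simp [this]
  have h1 : ∑ v, ∑ j, c (Sum.inl v) j *
      (staticVector m f (Sum.inl v) - staticVector m f j) ^ 2 ≤ 40 + 5 * m := by
    simp only [Fintype.sum_sum_type, staticVector, Sum.elim_inl, Sum.elim_inr, Pi.zero_apply,
      sub_zero, Finset.sum_add_distrib]
    refine add_le_add ?_ ?_
    · refine (Finset.sum_le_sum fun v _ => hstatic v).trans_eq ?_
      rw [Finset.sum_const, Finset.card_univ, Fintype.card_prod, Fintype.card_fin, nsmul_eq_mul]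
      push_cast
      field_simp
    · rw [Finset.sum_comm]
      refine (Finset.sum_le_sum fun k _ => Finset.sum_le_sum fun v _ => hmobile v k).trans ?_
      have h5 : ∀ k : Fin m, ∑ v, (if v ∈ closedNbhd (l (Sum.inr k)) then (1 : ℝ) else 0) ≤ 5 := by
        intro k
        rw [Finset.sum_boole, Finset.filter_mem_eq_inter, Finset.univ_inter]
        exact_mod_cast card_closedNbhd_le hL _
      refine (Finset.sum_le_sum fun k _ => h5 k).trans_eq ?_
      simp [mul_comm]
  have h2 : ∑ k, ∑ j, c (Sum.inr k) j *
      (staticVector m f (Sum.inr k) - staticVector m f j) ^ 2 ≤ m := by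
    have h3 : ∀ k, ∑ j, c (Sum.inr k) j *
        (staticVector m f (Sum.inr k) - staticVector m f j) ^ 2 ≤ 1 := by
      intro k
      rw [← hc1 (Sum.inr k)]
      refine Finset.sum_le_sum fun j _ => mul_le_of_le_one_right (hc0 _ _) ?_
      have : staticVector m f (Sum.inr k) = 0 := rfl
      rw [this, zero_sub, neg_sq]
      exact (sq_le_one_iff_abs_le_one _).2 (abs_staticVector_le hf j)
    exact (Finset.sum_le_sum fun k _ => h3 k).trans_eq (by simp)
  rw [Fintype.sum_sum_type]
  linarith

variable [NeZero L]

theorem pairEnergy_staticVector_le (hL : 2 ≤ L) (hm : 1 ≤ m) {f : Fin L → ℝ}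
    (hf : ∀ a, |f a| ≤ 1)
    (hadj : ∀ a b, (SimpleGraph.cycleGraph L).Adj a b → (f a - f b) ^ 2 ≤ 40 / (L : ℝ) ^ 2) :
    pairEnergy (pairLaw (torusGraph L) (staticPlusMobile L m)) (staticVector m f) ≤
      46 * m / (L : ℝ) ^ 2 := by
  have hm' : (1 : ℝ) ≤ m := by exact_mod_cast hm
  rw [pairEnergy_pairLaw]
  have h1 : ∑ l, (locationLaw (staticPlusMobile L m) l).toReal * ∑ i, ∑ j,
      (chooseNeighbor (torusGraph L) l i j).toReal *
        (staticVector m f i - staticVector m f j) ^ 2 ≤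
      ∑ l, (locationLaw (staticPlusMobile L m) l).toReal * (46 * m) := by
    refine Finset.sum_le_sum fun l _ => ?_
    by_cases hl : (locationLaw (staticPlusMobile L m) l).toReal = 0
    · simp [hl]
    · refine mul_le_mul_of_nonneg_left ?_ ENNReal.toReal_nonneg
      refine (sum_chooseNeighbor_mul_le hL hf hadj
        (apply_inl_of_locationLaw_ne_zero hl)).trans ?_
      linarith
  rw [← Finset.sum_mul, sum_toReal_eq_one, one_mul] at h1
  have hcard : (L : ℝ) ^ 2 ≤ Fintype.card ((Fin L × Fin L) ⊕ Fin m) := by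
    simp only [Fintype.card_sum, Fintype.card_prod, Fintype.card_fin]
    push_cast
    nlinarith
  have hn : (0 : ℝ) < (L : ℝ) ^ 2 := by
    have : (0 : ℝ) < L := by exact_mod_cast (by omega : 0 < L)
    positivity
  rw [div_eq_inv_mul]
  exact mul_le_mul (inv_anti₀ hn hcard) h1
    (Finset.sum_nonneg fun _ _ => mul_nonneg ENNReal.toReal_nonneg (Finset.sum_nonneg fun _ _ =>
      Finset.sum_nonneg fun _ _ => mul_nonneg ENNReal.toReal_nonneg (sq_nonneg _)))
    (by positivity)

/-- A test vector of mean zero whose Rayleigh quotient is at most both `46 m / n ^ 2` and `1 / 2`.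
The second bound is what keeps the estimate meaningful for small tori. -/
theorem exists_slow_vector (hL : 2 ≤ L) (hm : 1 ≤ m) :
    ∃ x : (Fin L × Fin L) ⊕ Fin m → ℝ, x ≠ 0 ∧ vecMean x = 0 ∧
      pairEnergy (pairLaw (torusGraph L) (staticPlusMobile L m)) x ≤
        2 * min (1 / 2) (46 * m / ((L : ℝ) ^ 2) ^ 2) * (x ⬝ᵥ x) := by
  obtain ⟨f, hsum, hf, hadj, hlow, hfour⟩ := exists_slow_function_on_cycle hL
  have hL0 : (0 : ℝ) < L := by exact_mod_cast (by omega : 0 < L)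
  have hxx := staticVector_dotProduct_self (m := m) f
  refine ⟨staticVector m f, ?_, vecMean_staticVector hsum, ?_⟩
  · intro h
    rw [h, zero_dotProduct] at hxx
    linarith
  · rw [hxx]
    rcases min_choice (1 / 2 : ℝ) (46 * m / ((L : ℝ) ^ 2) ^ 2) with h | h <;> rw [h]
    · have h4 : pairEnergy (pairLaw (torusGraph L) (staticPlusMobile L m)) (staticVector m f) ≤
          ∑ p, (pairLaw (torusGraph L) (staticPlusMobile L m) p).toReal * 4 := by
        refine Finset.sum_le_sum fun p _ => mul_le_mul_of_nonneg_left ?_ ENNReal.toReal_nonneg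
        have h1 := abs_le.1 (abs_staticVector_le (m := m) hf p.1)
        have h2 := abs_le.1 (abs_staticVector_le (m := m) hf p.2)
        nlinarith
      rw [← Finset.sum_mul, sum_toReal_eq_one, one_mul] at h4
      linarith
    · refine (pairEnergy_staticVector_le hL hm hf hadj).trans ?_
      calc 46 * (m : ℝ) / (L : ℝ) ^ 2
          = 2 * (46 * m / ((L : ℝ) ^ 2) ^ 2) * (L * (L / 2)) := by field_simp
        _ ≤ _ := by gcongr

end TestVector

/-! ### The averaging time -/

/-- `1 / (ε (2 - ε))` is at least a power of `1 / ε`, uniformly for `ε ≤ ε₀ < 1`. -/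
theorem exists_mul_log_inv_le {ε₀ : ℝ} (hε₀ : 0 < ε₀) (hε₀' : ε₀ < 1) :
    ∃ c : ℝ, 0 < c ∧ ∀ ε, 0 < ε → ε ≤ ε₀ →
      c * Real.log ε⁻¹ ≤ Real.log (ε * (2 - ε))⁻¹ := by
  have h0 : ε₀ * (2 - ε₀) < 1 := by nlinarith [sq_pos_of_pos (sub_pos.2 hε₀')]
  have h0' : 0 < ε₀ * (2 - ε₀) := mul_pos hε₀ (by linarith)
  set κ := Real.log (ε₀ * (2 - ε₀))⁻¹ with hκ
  have hκpos : 0 < κ := Real.log_pos ((one_lt_inv₀ h0').2 h0)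
  have hlog4 : 0 < Real.log 4 := Real.log_pos (by norm_num)
  refine ⟨min (1 / 2) (κ / Real.log 4), by positivity, fun ε hε hle => ?_⟩
  have hprod : 0 < ε * (2 - ε) := mul_pos hε (by linarith)
  have hlog : 0 ≤ Real.log ε⁻¹ := Real.log_nonneg ((one_le_inv₀ hε).2 (by linarith))
  rcases le_or_gt ε (1 / 4) with h | h
  · have h1 : Real.log 2 ≤ Real.log ε⁻¹ / 2 := by
      have h2 : Real.log 4 = 2 * Real.log 2 := by
        rw [← Real.log_rpow (by norm_num)]; norm_num
      have h3 : Real.log 4 ≤ Real.log ε⁻¹ := by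
        refine Real.log_le_log (by norm_num) ?_
        rw [le_inv_comm₀ (by norm_num) hε]
        linarith
      linarith
    have h2 : Real.log (ε * (2 - ε)) ≤ Real.log 2 + Real.log ε := by
      rw [← Real.log_mul (by norm_num) hε.ne']
      exact Real.log_le_log hprod (by nlinarith)
    rw [Real.log_inv] at *
    rw [Real.log_inv]
    have h3 := mul_le_mul_of_nonneg_right (min_le_left (1 / 2) (κ / Real.log 4)) hlog
    linarith
  · have h1 : Real.log ε⁻¹ ≤ Real.log 4 := by
      refine Real.log_le_log (by positivity) ?_
      rw [inv_le_comm₀ hε (by norm_num)]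
      linarith
    have h2 : κ ≤ Real.log (ε * (2 - ε))⁻¹ := by
      refine Real.log_le_log (by positivity) (inv_anti₀ hprod ?_)
      nlinarith
    calc min (1 / 2) (κ / Real.log 4) * Real.log ε⁻¹ ≤ κ / Real.log 4 * Real.log 4 := by
          gcongr
          exact min_le_right _ _
      _ = κ := by field_simp
      _ ≤ _ := h2

theorem averagingTime_le {A V : Type*} [Fintype A] [Nonempty A] [Fintype V] (G : SimpleGraph V)
    (μ : A → PMF V) {γ : ℝ} (hγ : γ ≤ 1)
    (h : ∀ x, 2 * γ * spread x ≤ pairEnergy (pairLaw G μ) x) {ε : ℝ} (hε : 0 < ε)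
    {t : ℕ} (ht : 3 * Real.log ε⁻¹ ≤ γ * t) : averagingTime G μ ε ≤ t := by
  refine iSup₂_le fun x₀ hx₀ => iInf₂_le t (toOuterMeasure_relError_le G μ hγ h hε hx₀ ?_)
  calc (1 - γ) ^ t ≤ Real.exp (-γ) ^ t :=
        pow_le_pow_left₀ (by linarith) (by linarith [Real.add_one_le_exp (-γ)]) t
    _ = Real.exp (-(γ * t)) := by rw [← Real.exp_nat_mul]; ring_nf
    _ ≤ Real.exp (3 * Real.log ε) := by
        rw [Real.log_inv] at ht
        exact Real.exp_le_exp.2 (by linarith)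
    _ = ε ^ 3 := by
        rw [mul_comm, Real.exp_mul, Real.exp_log hε]
        exact_mod_cast Real.rpow_natCast ε 3

theorem le_averagingTime {A V : Type*} [Fintype A] [Nonempty A] [Fintype V] (G : SimpleGraph V)
    (μ : A → PMF V) {δ : ℝ} (hδ0 : 0 ≤ δ) (hδ : δ ≤ 1 / 2) {x₀ : A → ℝ} (hx₀ : x₀ ≠ 0)
    (hmean : vecMean x₀ = 0)
    (h : pairEnergy (pairLaw G μ) x₀ ≤ 2 * δ * (x₀ ⬝ᵥ x₀)) {ε : ℝ} (hε : 0 < ε) (hε' : ε ≤ 1)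
    {k : ℕ} (hk : ∀ t : ℕ, Real.log (ε * (2 - ε))⁻¹ ≤ 2 * δ * t → k ≤ t) :
    (k : ℕ∞) ≤ averagingTime G μ ε := by
  refine le_iSup₂_of_le x₀ hx₀ (le_iInf₂ fun t ht => ?_)
  have hpow := pow_le_of_toOuterMeasure_relError_le G μ (by linarith) hx₀ hmean h hε hε' ht
  refine Nat.cast_le.2 (hk t ?_)
  have hexp : Real.exp (-(2 * δ)) ≤ 1 - δ := by
    rw [Real.exp_neg, inv_le_comm₀ (Real.exp_pos _) (by linarith)]
    refine le_trans ?_ (Real.add_one_le_exp (2 * δ))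
    rw [inv_le_iff_one_le_mul₀ (by linarith)]
    nlinarith
  have h1 : Real.exp (-(2 * δ * t)) ≤ ε * (2 - ε) := by
    refine le_trans ?_ hpow
    rw [show -(2 * δ * t) = t * -(2 * δ) by ring, Real.exp_nat_mul]
    exact pow_le_pow_left₀ (Real.exp_pos _).le hexp t
  have h2 := Real.log_le_log (Real.exp_pos _) h1
  rw [Real.log_exp] at h2
  rw [Real.log_inv]
  linarith

theorem theorem4 (ε₀ : ℝ) (hε₀ : 0 < ε₀) (hε₀' : ε₀ < 1) :
    ∃ c C : ℝ, 0 < c ∧ 0 < C ∧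
      ∀ (L : ℕ) [NeZero L] (n m : ℕ), n = L ^ 2 → 2 ≤ n → 1 ≤ m → m ≤ n →
        ∀ ε : ℝ, 0 < ε → ε ≤ ε₀ →
          ENNReal.ofReal (c * ((n : ℝ) ^ 2 / (m : ℝ) * Real.log ε⁻¹))
              ≤ ((averagingTime (torusGraph L) (staticPlusMobile L m) ε : ℕ∞) : ℝ≥0∞) ∧
            ((averagingTime (torusGraph L) (staticPlusMobile L m) ε : ℕ∞) : ℝ≥0∞)
              ≤ ENNReal.ofReal (C * ((n : ℝ) ^ 2 / (m : ℝ) * Real.log ε⁻¹)) := by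
  obtain ⟨κ, hκ, hκle⟩ := exists_mul_log_inv_le hε₀ hε₀'
  have hlog₀ : 0 < Real.log ε₀⁻¹ := Real.log_pos ((one_lt_inv₀ hε₀).2 hε₀')
  refine ⟨κ / 92, 132 + (Real.log ε₀⁻¹)⁻¹, by positivity, by positivity, ?_⟩
  rintro L _ n m rfl hn hm hmn ε hε hle
  have hL : 2 ≤ L := by
    by_contra! h
    interval_cases L <;> omega
  have hm0 : (0 : ℝ) < m := by exact_mod_cast hm
  have hL0 : (0 : ℝ) < L := by exact_mod_cast (by omega : 0 < L)
  have hmn' : (m : ℝ) ≤ (L : ℝ) ^ 2 := by exact_mod_cast hmn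
  have hn1 : (1 : ℝ) ≤ (L : ℝ) ^ 2 := by exact_mod_cast (by omega : 1 ≤ L ^ 2)
  have hlog : Real.log ε₀⁻¹ ≤ Real.log ε⁻¹ :=
    Real.log_le_log (by positivity) (inv_anti₀ hε hle)
  push_cast
  set X := ((L : ℝ) ^ 2) ^ 2 / m * Real.log ε⁻¹ with hX
  have hmn2 : (m : ℝ) ≤ ((L : ℝ) ^ 2) ^ 2 := by nlinarith
  have hXlow : Real.log ε₀⁻¹ ≤ X :=
    hlog.trans (le_mul_of_one_le_left (hlog₀.le.trans hlog) ((one_le_div₀ hm0).2 hmn2))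
  constructor
  · obtain ⟨x₀, hx₀, hmean, hx⟩ := exists_slow_vector (m := m) hL hm
    have h := le_averagingTime (torusGraph L) (staticPlusMobile L m) (by positivity)
      (min_le_left _ _) hx₀ hmean hx hε (by linarith) (k := ⌈κ / 92 * X⌉₊) (by
        intro t ht
        rw [Nat.ceil_le]
        have h1 : κ * Real.log ε⁻¹ ≤ 2 * (46 * m / ((L : ℝ) ^ 2) ^ 2) * t := by
          refine (hκle ε hε hle).trans (ht.trans ?_)
          gcongr
          exact min_le_right _ _
        have h2 : κ / 92 * X = κ * Real.log ε⁻¹ * (((L : ℝ) ^ 2) ^ 2 / m / 92) := by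
          rw [hX]; ring
        rw [h2]
        refine (mul_le_mul_of_nonneg_right h1 (by positivity)).trans_eq ?_
        field_simp
        ring)
    calc ENNReal.ofReal (κ / 92 * X) ≤ ENNReal.ofReal (⌈κ / 92 * X⌉₊ : ℝ) :=
          ENNReal.ofReal_le_ofReal (Nat.le_ceil _)
      _ = ((⌈κ / 92 * X⌉₊ : ℕ∞) : ℝ≥0∞) := by simp
      _ ≤ _ := ENat.toENNReal_le.2 h
  · have hγ1 : (m : ℝ) / (44 * ((L : ℝ) ^ 2) ^ 2) ≤ 1 := by
      rw [div_le_one₀ (by positivity)]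
      linarith
    have h := averagingTime_le (torusGraph L) (staticPlusMobile L m) hγ1
      (spread_le_pairEnergy hL hmn) hε (t := ⌈132 * X⌉₊) (by
        refine le_trans (le_of_eq ?_)
          (mul_le_mul_of_nonneg_left (Nat.le_ceil (132 * X)) (by positivity))
        rw [hX]
        field_simp
        ring)
    calc _ ≤ ((⌈132 * X⌉₊ : ℕ∞) : ℝ≥0∞) := ENat.toENNReal_le.2 h
      _ = ENNReal.ofReal (⌈132 * X⌉₊ : ℝ) := by simp
      _ ≤ _ := by
        apply ENNReal.ofReal_le_ofReal
        have h1 : (1 : ℝ) ≤ (Real.log ε₀⁻¹)⁻¹ * X := by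
          rw [inv_mul_eq_div]
          exact (one_le_div₀ hlog₀).2 hXlow
        have h2 := Nat.ceil_lt_add_one (a := 132 * X) (by linarith)
        linarith
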